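/- For an integer $m\ge 0$ let $B(m)$ be the number of triples $(\pi_1,\pi_2,\pi_3)$ of (possibly empty) partitions whose sizes add up to $m$, such that $\pi_1$ and $\pi_2$ each have distinct odd parts and all parts of $\pi_3$ are divisible by $4$; equivalently, $$\sum_{m\ge 0}B(m)q^m=\frac{f_2^4}{f_1^2f_4^3},\qquad f_j=\prod_{i\ge 1}(1-q^{ij}).$$ Put $B(m)=0$ for $m<0$. Theorem 1.5. For all primes $p$ with $p\equiv 7$ or $11\pmod{12}$, all integers $n\ge 0$ and all $r\in\{1,\ldots,p-1\}$, $$\sum_{k=-\infty}^{\infty}(-1)^k\,B\!\left(3p^2n+3pr+\frac{5(p^2-1)}{4}+1-6k(3k+1)\right)\equiv 0\pmod 9,$$ where only finitely many terms of the sum are nonzero. -/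

import Mathlib

/-- The partition triples `π = (π₁, π₂, π₃)` of `n` (the sizes `m 0`, `m 1`, `m 2` of the three
partitions, possibly zero, add up to `n`) such that `π₁` and `π₂` consist of distinct odd parts
and all parts of `π₃` are divisible by `4`. -/
def restrictedTriples (n : ℕ) :
    Finset (Σ m : Fin 3 → ℕ,
      Nat.Partition (m 0) × Nat.Partition (m 1) × Nat.Partition (m 2)) :=
  (Finset.Nat.antidiagonalTuple 3 n).sigma fun m =>
    Nat.Partition.oddDistincts (m 0) ×ˢ
      (Nat.Partition.oddDistincts (m 1) ×ˢ
        Nat.Partition.restricted (m 2) fun i => 4 ∣ i)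

/-- The number `B(n)` of these triples. -/
def tripleCount (n : ℕ) : ℕ :=
  (restrictedTriples n).card

/-- `B` extended to all integers by `B(m) = 0` for `m < 0`. -/
def tripleCountInt (m : ℤ) : ℤ :=
  if 0 ≤ m then (tripleCount m.toNat : ℤ) else 0

/-! Write `ψ(q) = f₂²/f₁` and `A(q) = f₂f₃²/(f₁f₆)`. The generating function of `B` is `ψ²/f₄³`, and
Euler's pentagonal theorem in `q¹²` turns the alternating sum into the coefficient of `q^N` in `f₁₂
∑ B(m) q^m` (`hasFiniteSupport_and_finsum_eq`). The theorem thus concerns exponents `N = 3M + 1` of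
this product.

Since `f₄⁹ ≡ f₁₂³` mod 9, the product times `f₁₂²` is `f₄⁶ψ²` mod 9 (`tripleSeries_congr`). The
3-dissections `ψ(q) = A(q³) + qψ(q⁹)` and, from Jacobi's formula, `f₁³ = P(q³) - 3q f₉³` isolate the
exponents `3M + 1`. With `θ = q d/dq` one has `P ≡ f₁ + 3θf₁` mod 9, and a logarithmic-derivative
argument mod 3 eliminates `θf₄`. The outcome is `sectionOne_tripleSeries_congr`: the coefficient at
`3M + 1` is `(2 + 3M) a(M)` mod 9, where `A(q)ψ(q³) = ∑ a(M) q^M`.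

If `a(M) ≠ 0`, then `24M + 10` is a sum of two squares. For the `M` in question a prime `p ≡ 3` mod
4 divides `24M + 10` exactly once, so `a(M) = 0`. -/

open PowerSeries Filter

/-! ### Gaussian binomials and the finite Jacobi triple product -/

section GaussBinom

variable {R : Type*} [CommRing R]

/-- The Gaussian binomial coefficient `[n, k]` at `Q`, defined by its Pascal recursion. -/
def gaussBinom (Q : R) : ℕ → ℕ → R
  | _, 0 => 1
  | 0, _ + 1 => 0
  | n + 1, k + 1 => gaussBinom Q n k + Q ^ (k + 1) * gaussBinom Q n (k + 1)

@[simp] theorem gaussBinom_zero_right (Q : R) (n : ℕ) : gaussBinom Q n 0 = 1 := by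
  cases n <;> rfl

theorem gaussBinom_succ_succ (Q : R) (n k : ℕ) :
    gaussBinom Q (n + 1) (k + 1) = gaussBinom Q n k + Q ^ (k + 1) * gaussBinom Q n (k + 1) := rfl

theorem gaussBinom_eq_zero (Q : R) {n k : ℕ} (h : n < k) : gaussBinom Q n k = 0 := by
  induction n generalizing k with
  | zero => obtain ⟨k, rfl⟩ := Nat.exists_eq_succ_of_ne_zero h.ne'; rfl
  | succ n ih =>
    obtain ⟨k, rfl⟩ := Nat.exists_eq_succ_of_ne_zero (Nat.ne_zero_of_lt h)
    rw [Nat.succ_eq_add_one, gaussBinom_succ_succ, ih (by omega), ih (by omega)]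
    ring

@[simp] theorem gaussBinom_self (Q : R) (n : ℕ) : gaussBinom Q n n = 1 := by
  induction n with
  | zero => rfl
  | succ n ih => rw [gaussBinom_succ_succ, ih, gaussBinom_eq_zero Q (Nat.lt_succ_self n)]; ring

/-- The finite `q`-factorial product `∏ (1 - Q ^ i)` over `1 ≤ i ≤ n`. -/
def eulerProd (Q : R) (n : ℕ) : R := ∏ i ∈ Finset.range n, (1 - Q ^ (i + 1))

theorem eulerProd_succ (Q : R) (n : ℕ) : eulerProd Q (n + 1) = eulerProd Q n * (1 - Q ^ (n + 1)) :=
  Finset.prod_range_succ _ _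

theorem gaussBinom_mul_eulerProd (Q : R) (n k : ℕ) :
    gaussBinom Q (n + k) k * eulerProd Q k * eulerProd Q n = eulerProd Q (n + k) := by
  induction n generalizing k with
  | zero => simp [eulerProd]
  | succ n ihn =>
    induction k with
    | zero => simp [eulerProd]
    | succ k ihk =>
      have h1 := ihn (k + 1)
      rw [show n + 1 + (k + 1) = (n + 1 + k) + 1 by ring, gaussBinom_succ_succ,
        eulerProd_succ Q (n + 1 + k)]
      rw [show n + (k + 1) = n + 1 + k by ring] at h1
      rw [eulerProd_succ Q n] at ihk ⊢
      rw [eulerProd_succ Q k] at h1 ⊢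
      linear_combination (1 - Q ^ (k + 1)) * ihk + Q ^ (k + 1) * (1 - Q ^ (n + 1)) * h1

/-- The `q`-binomial theorem. -/
theorem prod_one_add_mul_pow (Q a : R) (n : ℕ) :
    ∏ i ∈ Finset.range n, (1 + a * Q ^ i) =
      ∑ k ∈ Finset.range (n + 1), gaussBinom Q n k * (Q ^ k.choose 2 * a ^ k) := by
  induction n generalizing a with
  | zero => simp
  | succ n ih =>
    rw [Finset.prod_range_succ']
    have h : ∀ i, (1 + a * Q ^ (i + 1)) = 1 + (a * Q) * Q ^ i := fun i => by ring
    simp_rw [h]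
    rw [ih, Finset.sum_range_succ' _ (n + 1)]
    simp_rw [gaussBinom_succ_succ, add_mul]
    rw [Finset.sum_add_distrib]
    have h2 : ∑ k ∈ Finset.range (n + 1),
        Q ^ (k + 1) * gaussBinom Q n (k + 1) * (Q ^ (k + 1).choose 2 * a ^ (k + 1)) =
        ∑ k ∈ Finset.range (n + 1), gaussBinom Q n k * (Q ^ k.choose 2 * (a * Q) ^ k) - 1 := by
      rw [Finset.sum_range_succ' (fun k => gaussBinom Q n k * (Q ^ k.choose 2 * (a * Q) ^ k)),
        Finset.sum_range_succ, gaussBinom_eq_zero Q (Nat.lt_succ_self n)]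
      simp only [gaussBinom_zero_right, Nat.choose_zero_succ, pow_zero, mul_one, mul_zero,
        zero_mul, add_zero, add_sub_cancel_right]
      exact Finset.sum_congr rfl fun k _ => by ring
    have h3 : ∑ k ∈ Finset.range (n + 1),
        gaussBinom Q n k * (Q ^ (k + 1).choose 2 * a ^ (k + 1)) =
        a * ∑ k ∈ Finset.range (n + 1), gaussBinom Q n k * (Q ^ k.choose 2 * (a * Q) ^ k) := by
      rw [Finset.mul_sum]
      refine Finset.sum_congr rfl fun k _ => ?_
      rw [Nat.choose_succ_succ' k 1, Nat.choose_one_right]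
      ring
    rw [h2, h3]
    simp
    ring

/-- The term `a ^ (j (j + 1) / 2) * b ^ (j (j - 1) / 2)` of Ramanujan's theta function. -/
def thetaTerm (a b : R) : ℤ → R
  | Int.ofNat k => (a * b) ^ k.choose 2 * a ^ k
  | Int.negSucc k => (a * b) ^ (k + 1).choose 2 * b ^ (k + 1)

theorem thetaTerm_natCast (a b : R) (k : ℕ) :
    thetaTerm a b (k : ℤ) = (a * b) ^ k.choose 2 * a ^ k := rfl

theorem thetaTerm_neg_natCast (a b : R) (k : ℕ) :
    thetaTerm a b (-(k : ℤ)) = (a * b) ^ k.choose 2 * b ^ k := by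
  cases k with
  | zero => exact (thetaTerm_natCast a b 0).trans (by simp)
  | succ k => rfl

/-- The shift relation between neighbouring theta terms; it matches the Pascal recursion when one
more factor in `b` is multiplied into the finite triple product. -/
theorem mul_thetaTerm (a b : R) (m k : ℕ) :
    b * (a * b) ^ m * thetaTerm a b ((k : ℤ) - m) =
      (a * b) ^ k * thetaTerm a b ((k : ℤ) - (m + 1 : ℕ)) := by
  rcases le_or_gt (m + 1) k with h | h
  · obtain ⟨c, rfl⟩ := Nat.exists_eq_add_of_le h
    rw [show ((m + 1 + c : ℕ) : ℤ) - m = ((c + 1 : ℕ) : ℤ) by push_cast; ring,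
      show ((m + 1 + c : ℕ) : ℤ) - (m + 1 : ℕ) = (c : ℤ) by push_cast; ring,
      thetaTerm_natCast, thetaTerm_natCast, Nat.choose_succ_succ' c 1, Nat.choose_one_right]
    ring
  · obtain ⟨c, rfl⟩ := Nat.exists_eq_add_of_le (Nat.lt_succ_iff.mp h)
    rw [show (k : ℤ) - (k + c : ℕ) = -(c : ℤ) by push_cast; ring,
      show (k : ℤ) - (k + c + 1 : ℕ) = -((c + 1 : ℕ) : ℤ) by push_cast; ring,
      thetaTerm_neg_natCast, thetaTerm_neg_natCast, Nat.choose_succ_succ' c 1,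
      Nat.choose_one_right]
    ring

/-- The finite form of the Jacobi triple product identity. -/
theorem prod_mul_prod_eq_sum_gaussBinom (a b : R) (n m : ℕ) :
    (∏ i ∈ Finset.range n, (1 + a * (a * b) ^ i)) * ∏ i ∈ Finset.range m, (1 + b * (a * b) ^ i) =
      ∑ k ∈ Finset.range (n + m + 1), gaussBinom (a * b) (n + m) k *
        thetaTerm a b ((k : ℤ) - m) := by
  induction m with
  | zero =>
    rw [prod_one_add_mul_pow]
    simp [thetaTerm_natCast]
  | succ m ih =>
    rw [Finset.prod_range_succ, ← mul_assoc, ih, mul_add, mul_one, Finset.sum_mul,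
      ← add_assoc n m 1, Finset.sum_range_succ' _ (n + m + 1)]
    have h1 : ∀ k ∈ Finset.range (n + m + 1), gaussBinom (a * b) (n + m) k *
        thetaTerm a b ((k : ℤ) - m) * (b * (a * b) ^ m) =
        (a * b) ^ k * gaussBinom (a * b) (n + m) k * thetaTerm a b ((k : ℤ) - (m + 1 : ℕ)) :=
      fun k _ => by linear_combination gaussBinom (a * b) (n + m) k * mul_thetaTerm a b m k
    have h2 : ∀ k : ℕ, ((k + 1 : ℕ) : ℤ) - (m + 1 : ℕ) = (k : ℤ) - m :=
      fun k => by push_cast; ring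
    rw [Finset.sum_congr rfl h1, Finset.sum_range_succ' (fun k =>
      (a * b) ^ k * gaussBinom (a * b) (n + m) k * thetaTerm a b ((k : ℤ) - (m + 1 : ℕ))) (n + m)]
    simp_rw [gaussBinom_succ_succ, add_mul, h2]
    rw [Finset.sum_add_distrib, Finset.sum_range_succ (fun k =>
      (a * b) ^ (k + 1) * gaussBinom (a * b) (n + m) (k + 1) * thetaTerm a b ((k : ℤ) - m)),
      gaussBinom_eq_zero _ (Nat.lt_succ_self (n + m))]
    simp
    ring

end GaussBinom

/-! ### X-adic limits and the infinite Jacobi triple product -/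

section AdicTendsto

variable {R : Type*} [CommRing R]

/-- The sequence `u` of power series converges `X`-adically to `F`. -/
def AdicTendsto (u : ℕ → R⟦X⟧) (F : R⟦X⟧) : Prop :=
  ∀ d : ℕ, ∀ᶠ n in atTop, X ^ d ∣ u n - F

namespace AdicTendsto

variable {u v : ℕ → R⟦X⟧} {F G : R⟦X⟧}

theorem of_coeff (h : ∀ d : ℕ, ∀ᶠ n in atTop, coeff d (u n) = coeff d F) : AdicTendsto u F := by
  intro d
  have : ∀ᶠ n in atTop, ∀ i ∈ Finset.range d, coeff i (u n) = coeff i F :=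
    (Filter.eventually_all_finset _).2 fun i _ => h i
  filter_upwards [this] with n hn
  rw [X_pow_dvd_iff]
  intro i hi
  rw [map_sub, hn i (Finset.mem_range.2 hi), sub_self]

theorem mul (hu : AdicTendsto u F) (hv : AdicTendsto v G) :
    AdicTendsto (fun n => u n * v n) (F * G) := by
  intro d
  filter_upwards [hu d, hv d] with n h1 h2
  have : u n * v n - F * G = (u n - F) * v n + F * (v n - G) := by ring
  rw [this]
  exact dvd_add (h1.mul_right _) (h2.mul_left _)

theorem unique (hu : AdicTendsto u F) (hv : AdicTendsto u G) : F = G := by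
  ext d
  obtain ⟨n, h1, h2⟩ := ((hu (d + 1)).and (hv (d + 1))).exists
  have h := dvd_sub h2 h1
  rw [sub_sub_sub_cancel_left, X_pow_dvd_iff] at h
  simpa [sub_eq_zero] using h d d.lt_succ_self

theorem comp (hu : AdicTendsto u F) {g : ℕ → ℕ} (hg : Tendsto g atTop atTop) :
    AdicTendsto (fun n => u (g n)) F := fun d => hg.eventually (hu d)

theorem comp_mul (hu : AdicTendsto u F) {k : ℕ} (hk : 0 < k) :
    AdicTendsto (fun n => u (k * n)) F :=
  hu.comp (tendsto_id.const_mul_atTop' hk)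

theorem congr (hu : AdicTendsto u F) (h : ∀ n, u n = v n) : AdicTendsto v F :=
  (funext h : u = v) ▸ hu

theorem map {S : Type*} [CommRing S] (hu : AdicTendsto u F) (f : R⟦X⟧ →+* S⟦X⟧)
    (hf : X ∣ f X) : AdicTendsto (fun n => f (u n)) (f F) := by
  intro d
  filter_upwards [hu d] with n h
  rw [← map_sub]
  exact ((pow_dvd_pow_of_dvd hf d).trans (by rw [← map_pow])).trans (map_dvd f h)

open WithPiTopology in
theorem of_hasProd [TopologicalSpace R] [DiscreteTopology R] {f : ℕ → R⟦X⟧} (h : HasProd f F) :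
    AdicTendsto (fun n => ∏ i ∈ Finset.range n, f i) F := by
  refine of_coeff fun d => ?_
  have := (tendsto_iff_coeff_tendsto _ _ _ _).1 h.tendsto_prod_nat d
  rwa [nhds_discrete, tendsto_pure] at this

end AdicTendsto

theorem X_pow_dvd_eulerProd_sub {m : ℕ} (hm : 0 < m) {d n : ℕ} (h : d ≤ n) :
    (X : R⟦X⟧) ^ d ∣ eulerProd (X ^ m) n - eulerProd (X ^ m) d := by
  obtain ⟨c, rfl⟩ := Nat.exists_eq_add_of_le h
  induction c with
  | zero => simp
  | succ c ih =>
    rw [← add_assoc, eulerProd_succ]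
    have : eulerProd ((X : R⟦X⟧) ^ m) (d + c) * (1 - (X ^ m) ^ (d + c + 1)) -
        eulerProd (X ^ m) d = (eulerProd (X ^ m) (d + c) - eulerProd (X ^ m) d) -
        X ^ (m * (d + c + 1)) * eulerProd (X ^ m) (d + c) := by ring
    rw [this]
    exact dvd_sub (ih (by omega)) ((pow_dvd_pow _ (by nlinarith)).mul_right _)

theorem isUnit_eulerProd {m : ℕ} (hm : 0 < m) (n : ℕ) : IsUnit (eulerProd ((X : R⟦X⟧) ^ m) n) := by
  rw [PowerSeries.isUnit_iff_constantCoeff, eulerProd, map_prod]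
  simp [hm.ne']

/-- Modulo `X ^ d` all the Euler products involved agree with the one of length `d`, a unit that can
be cancelled from `gaussBinom_mul_eulerProd`. -/
theorem X_pow_dvd_gaussBinom_mul_sub_one {m : ℕ} (hm : 0 < m) {d n k N : ℕ} (hn : d ≤ n)
    (hk : d ≤ k) (hN : d ≤ N) :
    (X : R⟦X⟧) ^ d ∣ gaussBinom (X ^ m) (n + k) k * eulerProd (X ^ m) N - 1 := by
  have h := gaussBinom_mul_eulerProd ((X : R⟦X⟧) ^ m) n k
  obtain ⟨x, hx⟩ := X_pow_dvd_eulerProd_sub (R := R) hm hn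
  obtain ⟨y, hy⟩ := X_pow_dvd_eulerProd_sub (R := R) hm hk
  obtain ⟨z, hz⟩ := X_pow_dvd_eulerProd_sub (R := R) hm hN
  obtain ⟨w, hw⟩ := X_pow_dvd_eulerProd_sub (R := R) hm (hn.trans (Nat.le_add_right n k))
  obtain ⟨e, he⟩ := (isUnit_eulerProd (R := R) hm d).exists_right_inv
  rw [sub_eq_iff_eq_add] at hx hy hz hw
  rw [hx, hy, hw] at h
  rw [hz]
  set P := eulerProd ((X : R⟦X⟧) ^ m) d
  set g := gaussBinom ((X : R⟦X⟧) ^ m) (n + k) k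
  refine ⟨e * (w - g * (y * (X ^ d * x + P) + P * x) ) + g * z, ?_⟩
  linear_combination e * h - (g * P - 1) * he

theorem le_choose_two_of_lt {d k : ℕ} (h : d < k) : d ≤ k.choose 2 := by
  obtain ⟨c, rfl⟩ := Nat.exists_eq_add_of_lt h
  rw [Nat.choose_succ_succ' (d + c) 1, Nat.choose_one_right]
  omega

theorem X_pow_dvd_thetaTerm {a b : R⟦X⟧} {m : ℕ} (hm : 0 < m) (hab : a * b = X ^ m) {d : ℕ}
    {j : ℤ} (h : d < j.natAbs) : X ^ d ∣ thetaTerm a b j := by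
  have key : ∀ k : ℕ, d < k → ∀ c : R⟦X⟧, X ^ d ∣ (a * b) ^ k.choose 2 * c := by
    intro k hk c
    rw [hab, ← pow_mul]
    exact (pow_dvd_pow _ ((le_choose_two_of_lt hk).trans (Nat.le_mul_of_pos_left _ hm))).mul_right _
  obtain ⟨k, rfl | rfl⟩ := j.eq_nat_or_neg
  · rw [thetaTerm_natCast]
    exact key k (by simpa using h) _
  · rw [thetaTerm_neg_natCast]
    exact key k (by simpa using h) _

/-- The **Jacobi triple product identity** for power series `a`, `b` with `a * b = X ^ m`. -/
theorem adicTendsto_tripleProduct {a b S : R⟦X⟧} {m : ℕ} (hm : 0 < m) (hab : a * b = X ^ m)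
    (hS : AdicTendsto (fun n : ℕ => ∑ j ∈ Finset.Icc (-n : ℤ) n, thetaTerm a b j) S) :
    AdicTendsto (fun n => ∏ i ∈ Finset.range n,
      ((1 + a * X ^ (m * i)) * (1 + b * X ^ (m * i)) * (1 - X ^ (m * (i + 1))))) S := by
  intro d
  -- With `n > 2d`, every index `k` within `d` of the centre `n` is at least `d` away from both
  -- ends, so its Gaussian binomial is under control; for the other `k` the theta term itself
  -- vanishes mod `X ^ d`.
  filter_upwards [hS d, eventually_ge_atTop (2 * d + 1)] with n h1 hn
  rw [← sub_add_sub_cancel _ (∑ j ∈ Finset.Icc (-n : ℤ) n, thetaTerm a b j) S]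
  refine dvd_add ?_ h1
  have hsum : ∑ j ∈ Finset.Icc (-n : ℤ) n, thetaTerm a b j =
      ∑ k ∈ Finset.range (n + n + 1), thetaTerm a b ((k : ℤ) - n) := by
    refine Finset.sum_nbij' (fun j => (j + n).toNat) (fun k => (k : ℤ) - n) ?_ ?_ ?_ ?_ ?_
    · intro j hj
      simp only [Finset.mem_Icc, Finset.mem_range] at hj ⊢
      omega
    · intro k hk
      simp only [Finset.mem_Icc, Finset.mem_range] at hk ⊢
      omega
    · intro j hj
      simp only [Finset.mem_Icc] at hj
      omega
    · intro k _
      simp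
    · intro j hj
      simp only [Finset.mem_Icc] at hj
      congr 1
      omega
  have hprod : ∏ i ∈ Finset.range n,
      ((1 + a * X ^ (m * i)) * (1 + b * X ^ (m * i)) * (1 - X ^ (m * (i + 1)))) =
      (∑ k ∈ Finset.range (n + n + 1), gaussBinom (X ^ m) (n + n) k *
        thetaTerm a b ((k : ℤ) - n)) * eulerProd (X ^ m) n := by
    have h := prod_mul_prod_eq_sum_gaussBinom a b n n
    rw [hab] at h
    rw [← h, eulerProd, ← Finset.prod_mul_distrib, ← Finset.prod_mul_distrib]
    exact Finset.prod_congr rfl fun i _ => by simp only [pow_mul]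
  rw [hsum, hprod, Finset.sum_mul, ← Finset.sum_sub_distrib]
  refine Finset.dvd_sum fun k hk => ?_
  rw [Finset.mem_range] at hk
  have : gaussBinom (X ^ m) (n + n) k * thetaTerm a b ((k : ℤ) - n) * eulerProd (X ^ m) n -
      thetaTerm a b ((k : ℤ) - n) = (gaussBinom (X ^ m) (n + n) k * eulerProd (X ^ m) n - 1) *
        thetaTerm a b ((k : ℤ) - n) := by ring
  rw [this]
  by_cases hkd : d < ((k : ℤ) - n).natAbs
  · exact (X_pow_dvd_thetaTerm hm hab hkd).mul_left _
  · refine Dvd.dvd.mul_right ?_ _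
    have h2 := X_pow_dvd_gaussBinom_mul_sub_one (R := R) hm (d := d) (n := n + n - k) (k := k)
      (N := n) (by omega) (by omega) (by omega)
    rwa [Nat.sub_add_cancel (by omega)] at h2

end AdicTendsto

/-! ### Euler products and the substitution `q ↦ q ^ m` -/

section Products

/-- The substitution `q ↦ q ^ m`. -/
noncomputable def dilate (m : ℕ) [NeZero m] : ℤ⟦X⟧ →ₐ[ℤ] ℤ⟦X⟧ := expand m (NeZero.ne m)

@[simp] theorem dilate_X (m : ℕ) [NeZero m] : dilate m X = X ^ m := expand_X _ _

theorem dilate_dilate {m n k : ℕ} [NeZero m] [NeZero n] [NeZero k] (h : m * n = k) (F : ℤ⟦X⟧) :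
    dilate m (dilate n F) = dilate k F := by
  subst h
  exact (expand_mul m (NeZero.ne m) n (NeZero.ne n) F).symm

theorem AdicTendsto.dilate {u : ℕ → ℤ⟦X⟧} {F : ℤ⟦X⟧} (hu : AdicTendsto u F) (m : ℕ) [NeZero m] :
    AdicTendsto (fun n => _root_.dilate m (u n)) (_root_.dilate m F) :=
  hu.map (_root_.dilate m : ℤ⟦X⟧ →+* ℤ⟦X⟧) (by
    rw [RingHom.coe_coe, dilate_X]
    exact dvd_pow_self _ (NeZero.ne m))

/-- The product `f_m = ∏ (1 - q ^ (m i))` over `i ≥ 1`. -/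
noncomputable def eulerSeries (m : ℕ) [NeZero m] : ℤ⟦X⟧ := dilate m (pentagonalSeries ℤ)

theorem dilate_eulerSeries {m n k : ℕ} [NeZero m] [NeZero n] [NeZero k] (h : m * n = k) :
    dilate m (eulerSeries n) = eulerSeries k := dilate_dilate h _

theorem eulerSeries_one : eulerSeries 1 = pentagonalSeries ℤ := by
  simp [eulerSeries, dilate]

theorem adicTendsto_eulerSeries (m : ℕ) [NeZero m] :
    AdicTendsto (fun n => ∏ i ∈ Finset.range n, (1 - X ^ (m * (i + 1)))) (eulerSeries m) := by
  have h : AdicTendsto (fun n => ∏ i ∈ Finset.range n, (1 - X ^ (i + 1))) (pentagonalSeries ℤ) :=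
    AdicTendsto.of_coeff fun d =>
      Filter.tendsto_finset_range.eventually (coeff_prod_one_sub_X_pow_eventually_eq ℤ d)
  refine (h.dilate m).congr fun n => ?_
  simp [map_prod, pow_mul]

theorem constantCoeff_eulerSeries (m : ℕ) [NeZero m] : constantCoeff (eulerSeries m) = 1 := by
  rw [eulerSeries, dilate, constantCoeff_expand, ← coeff_zero_eq_constantCoeff_apply]
  have := coeff_pentagonalSeries_pentagonal ℤ 0
  simpa [pentagonal_def] using this

theorem eulerSeries_ne_zero (m : ℕ) [NeZero m] : eulerSeries m ≠ 0 := fun h => by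
  have := constantCoeff_eulerSeries m
  simp [h] at this

theorem prod_range_mul {M : Type*} [CommMonoid M] (f : ℕ → M) (k n : ℕ) :
    ∏ i ∈ Finset.range (k * n), f i =
      ∏ i ∈ Finset.range n, ∏ j ∈ Finset.range k, f (k * i + j) := by
  induction n with
  | zero => simp
  | succ n ih => rw [Nat.mul_succ, Finset.prod_range_add, ih, Finset.prod_range_succ]

end Products

/-! ### Generating function of the partition triples -/

section Partitions

open Nat.Partition
open scoped PowerSeries.WithPiTopology

/-- The generating function of partitions into distinct odd parts. -/
noncomputable def oddDistinctSeries : ℤ⟦X⟧ :=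
  PowerSeries.mk fun n => ((oddDistincts n).card : ℤ)

/-- The generating function of partitions into multiples of `4`. -/
noncomputable def fourDvdSeries : ℤ⟦X⟧ :=
  PowerSeries.mk fun n => ((restricted n fun i => 4 ∣ i).card : ℤ)

/-- The generating function of `tripleCount`. -/
noncomputable def tripleSeries : ℤ⟦X⟧ := PowerSeries.mk fun n => (tripleCount n : ℤ)

theorem tripleSeries_eq : tripleSeries = oddDistinctSeries ^ 2 * fourDvdSeries := by
  ext n
  have h : ∀ a b c : ℕ → ℤ, coeff n (PowerSeries.mk a * (PowerSeries.mk b * PowerSeries.mk c)) =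
      ∑ m ∈ Finset.Nat.antidiagonalTuple 3 n, a (m 0) * (b (m 1) * c (m 2)) := by
    intro a b c
    simp only [coeff_mul, coeff_mk, Finset.mul_sum]
    rw [Finset.sum_sigma']
    refine Finset.sum_bij' (fun x _ => ![x.1.1, x.2.1, x.2.2])
      (fun m _ => ⟨(m 0, m 1 + m 2), (m 1, m 2)⟩) ?_ ?_ ?_ ?_ ?_
    · rintro ⟨⟨i, j⟩, ⟨k, l⟩⟩ hx
      simp only [Finset.mem_sigma, Finset.HasAntidiagonal.mem_antidiagonal] at hx
      simp [Finset.Nat.mem_antidiagonalTuple, Fin.sum_univ_succ]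
      omega
    · intro m hm
      rw [Finset.Nat.mem_antidiagonalTuple, Fin.sum_univ_three] at hm
      simp [← add_assoc, hm]
    · rintro ⟨⟨i, j⟩, ⟨k, l⟩⟩ hx
      simp only [Finset.mem_sigma, Finset.HasAntidiagonal.mem_antidiagonal] at hx
      obtain ⟨_, rfl⟩ := hx
      rfl
    · intro m _
      ext i
      fin_cases i <;> rfl
    · intro x _
      rfl
  rw [pow_two, mul_assoc, oddDistinctSeries, fourDvdSeries, h, tripleSeries, coeff_mk,
    tripleCount, restrictedTriples, Finset.card_sigma]
  push_cast [Finset.card_product]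
  rfl

theorem adicTendsto_oddDistinctSeries :
    AdicTendsto (fun n => ∏ i ∈ Finset.range n, if Odd (i + 1) then 1 + X ^ (i + 1) else 1)
      oddDistinctSeries := by
  have h := AdicTendsto.of_hasProd
    (hasProd_genFun (R := ℤ) fun i c => if Odd i ∧ c < 2 then (1 : ℤ) else 0)
  simp_rw [PowerSeries.smul_eq_C_mul] at h
  convert! h using 1
  · ext1 n
    refine Finset.prod_congr rfl fun i _ => ?_
    -- The index `j` stands for multiplicity `j + 1`, so distinctness leaves only `j = 0`.
    rw [tsum_eq_single 0 fun j hj => by rw [if_neg (by omega), map_zero, zero_mul]]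
    by_cases ho : Odd (i + 1) <;> simp [ho]
  · ext n
    simp_rw [oddDistinctSeries, genFun, coeff_mk, oddDistincts, odds, ← countRestricted_two,
      restricted, countRestricted, ← Finset.filter_and, Finset.card_filter, Finsupp.prod,
      Finset.prod_boole]
    push_cast
    refine Finset.sum_congr rfl fun x _ => ?_
    simp [← forall_and]

theorem adicTendsto_fourDvdSeries :
    AdicTendsto (fun n => ∏ i ∈ Finset.range n,
      if 4 ∣ i + 1 then ∑' j : ℕ, X ^ ((i + 1) * j) else 1) fourDvdSeries :=
  AdicTendsto.of_hasProd (hasProd_powerSeriesMk_card_restricted ℤ (4 ∣ ·))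

theorem fourDvdSeries_mul : fourDvdSeries * eulerSeries 4 = 1 := by
  refine ((adicTendsto_fourDvdSeries.comp_mul (by decide : 0 < 4)).mul
    (adicTendsto_eulerSeries 4)).unique ?_
  refine AdicTendsto.congr (u := fun _ => 1) (fun d => by simp) fun n => ?_
  rw [prod_range_mul, ← Finset.prod_mul_distrib, Finset.prod_eq_one]
  intro i _
  simp only [Finset.prod_range_succ, Finset.prod_range_zero]
  rw [if_neg (by omega), if_neg (by omega), if_neg (by omega), if_pos (by omega)]
  have h := WithPiTopology.tsum_pow_mul_one_sub_of_constantCoeff_eq_zero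
    (f := (X : ℤ⟦X⟧) ^ (4 * i + 3 + 1)) (by simp)
  simp_rw [← pow_mul] at h
  simp only [one_mul]
  exact h

/-- Pairing `1 + q^(2i+1)` with the odd factor `1 - q^(2i+1)` of `f₁` gives `1 - q^(4i+2)`, which
`f₄` completes to `f₂`; the even factors of `f₁` are the other `f₂`. The partial products are cut at
lengths making this exact for every `n`. -/
theorem oddDistinctSeries_mul :
    oddDistinctSeries * (eulerSeries 1 * eulerSeries 4) = eulerSeries 2 * eulerSeries 2 := by
  refine ((adicTendsto_oddDistinctSeries.comp_mul (by decide : 0 < 2)).mul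
    (((adicTendsto_eulerSeries 1).comp_mul (by decide : 0 < 2)).mul
      (adicTendsto_eulerSeries 4))).unique ?_
  refine (((adicTendsto_eulerSeries 2).comp_mul (by decide : 0 < 2)).mul
    (adicTendsto_eulerSeries 2)).congr fun n => ?_
  rw [prod_range_mul, prod_range_mul, prod_range_mul, ← Finset.prod_mul_distrib,
    ← Finset.prod_mul_distrib, ← Finset.prod_mul_distrib]
  refine Finset.prod_congr rfl fun i _ => ?_
  simp only [Finset.prod_range_succ, Finset.prod_range_zero]
  rw [if_pos ⟨i, by ring⟩, if_neg (by rw [Nat.not_odd_iff_even]; exact ⟨i + 1, by ring⟩)]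
  ring

end Partitions

/-! ### Product formulas for `ψ(q)`, `A(q)` and `ψ(-q)` -/

section ThetaSeries

theorem adicTendsto_sum_Icc {e : ℤ → ℕ} (he : Function.Injective e) {F : ℤ⟦X⟧}
    (h1 : ∀ j, coeff (e j) F = 1) (h2 : ∀ d, (∀ j, e j ≠ d) → coeff d F = 0) :
    AdicTendsto (fun n : ℕ => ∑ j ∈ Finset.Icc (-n : ℤ) n, X ^ e j) F := by
  refine AdicTendsto.of_coeff fun d => ?_
  simp_rw [map_sum, coeff_X_pow]
  by_cases hd : ∃ j, e j = d
  · obtain ⟨j, rfl⟩ := hd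
    filter_upwards [eventually_ge_atTop j.natAbs] with n hn
    simp_rw [h1, he.eq_iff]
    rw [Finset.sum_ite_eq, if_pos]
    rw [Finset.mem_Icc]
    omega
  · push Not at hd
    refine Eventually.of_forall fun n => ?_
    rw [h2 d hd, Finset.sum_eq_zero fun j _ => if_neg (hd j).symm]

/-- Ramanujan's `ψ(q) = ∑ q ^ (n (n + 1) / 2)`. -/
noncomputable def psiSeries : ℤ⟦X⟧ := PowerSeries.mk fun n => if IsSquare (8 * n + 1) then 1 else 0

/-- The unsigned pentagonal series `∑ q ^ (k (3 k + 1) / 2)`. -/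
noncomputable def pentSeries : ℤ⟦X⟧ := PowerSeries.mk fun n => if IsSquare (24 * n + 1) then 1 else 0

/-- The index `2 j² - j`. -/
def hexagonal (j : ℤ) : ℕ := (2 * j ^ 2 - j).toNat

theorem natCast_hexagonal (j : ℤ) : (hexagonal j : ℤ) = 2 * j ^ 2 - j := by
  rw [hexagonal, Int.toNat_of_nonneg]
  rcases le_or_gt j 0 with h | h <;> nlinarith

theorem hexagonal_injective : Function.Injective hexagonal := by
  intro x y h
  have h' : (hexagonal x : ℤ) = hexagonal y := by rw [h]
  rw [natCast_hexagonal, natCast_hexagonal] at h'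
  have : (2 * (x + y) - 1) * (x - y) = 0 := by linear_combination h'
  rcases mul_eq_zero.1 this with h | h <;> omega

theorem exists_hexagonal_eq {d : ℕ} (h : IsSquare (8 * d + 1)) : ∃ j, hexagonal j = d := by
  obtain ⟨s, hs⟩ := h
  have hs' : (8 * d + 1 : ℤ) = s * s := by exact_mod_cast hs
  have hodd : s % 4 = 1 ∨ s % 4 = 3 := by
    have : s % 2 = 1 := by
      by_contra h
      have h0 : s % 2 = 0 := by omega
      have := Nat.mul_mod s s 2
      rw [h0, ← hs] at this
      omega
    omega
  rcases hodd with h | h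
  -- The index solves `|4j - 1| = s`; the residue of `s` mod 4 decides its sign.
  · refine ⟨-(s / 4 : ℕ), ?_⟩
    have h2 := natCast_hexagonal (-(s / 4 : ℕ))
    have : (s : ℤ) = 4 * (s / 4 : ℕ) + 1 := by omega
    generalize s / 4 = t at *
    rw [this] at hs'
    zify
    linarith
  · refine ⟨(s / 4 + 1 : ℕ), ?_⟩
    have h2 := natCast_hexagonal (s / 4 + 1 : ℕ)
    have : (s : ℤ) = 4 * (s / 4 : ℕ) + 3 := by omega
    generalize s / 4 = t at *
    rw [this] at hs'
    push_cast at h2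
    zify
    linarith

theorem isSquare_hexagonal (j : ℤ) : IsSquare (8 * hexagonal j + 1) := by
  refine ⟨(4 * j - 1).natAbs, ?_⟩
  zify
  rw [natCast_hexagonal, abs_mul_abs_self]
  ring

theorem exists_pentagonal_eq {d : ℕ} (h : IsSquare (24 * d + 1)) : ∃ j, pentagonal j = d := by
  obtain ⟨s, hs⟩ := h
  have hs' : (24 * d + 1 : ℤ) = s * s := by exact_mod_cast hs
  have hmod : s % 6 = 1 ∨ s % 6 = 5 := by
    have h6 : (s % 6) * (s % 6) % 6 = 1 := by
      rw [← Nat.mul_mod, ← hs]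
      omega
    have : s % 6 < 6 := Nat.mod_lt _ (by norm_num)
    generalize s % 6 = r at *
    interval_cases r <;> simp_all
  rcases hmod with h | h
  · refine ⟨-(s / 6 : ℕ), ?_⟩
    have h2 := two_mul_natCast_pentagonal (-(s / 6 : ℕ))
    have : (s : ℤ) = 6 * (s / 6 : ℕ) + 1 := by omega
    generalize s / 6 = t at *
    rw [this] at hs'
    zify
    linarith
  · refine ⟨(s / 6 + 1 : ℕ), ?_⟩
    have h2 := two_mul_natCast_pentagonal (s / 6 + 1 : ℕ)
    have : (s : ℤ) = 6 * (s / 6 : ℕ) + 5 := by omega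
    generalize s / 6 = t at *
    rw [this] at hs'
    push_cast at h2
    zify
    linarith

theorem pentagonal_sq (j : ℤ) :
    24 * pentagonal j + 1 = (6 * j - 1).natAbs * (6 * j - 1).natAbs := by
  zify
  rw [abs_mul_abs_self]
  linear_combination 12 * two_mul_natCast_pentagonal j

theorem isSquare_pentagonal (j : ℤ) : IsSquare (24 * pentagonal j + 1) := ⟨_, pentagonal_sq j⟩

theorem succ_choose_two_mul_two (k : ℕ) : (k + 1).choose 2 * 2 = (k + 1) * k := by
  rw [Nat.choose_two_right, Nat.div_mul_cancel (Nat.even_mul_pred_self _).two_dvd,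
    Nat.add_sub_cancel]

theorem adicTendsto_psiSeries : AdicTendsto (fun n => ∏ i ∈ Finset.range n,
    ((1 + X ^ (4 * i + 1)) * (1 + X ^ (4 * i + 3)) * (1 - X ^ (4 * (i + 1))))) psiSeries := by
  have h := adicTendsto_tripleProduct (a := X) (b := X ^ 3) (S := psiSeries) (m := 4) (by decide)
    (by ring) ?_
  · refine h.congr fun n => Finset.prod_congr rfl fun i _ => ?_
    ring
  · refine (adicTendsto_sum_Icc hexagonal_injective (F := psiSeries) ?_ ?_).congr
      fun n => Finset.sum_congr rfl fun j _ => ?_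
    · intro j
      rw [psiSeries, coeff_mk, if_pos (isSquare_hexagonal j)]
    · intro d hd
      rw [psiSeries, coeff_mk, if_neg]
      exact fun hs => absurd (exists_hexagonal_eq hs) (by simpa using hd)
    · obtain ⟨k, rfl | rfl⟩ := j.eq_nat_or_neg
      · rw [thetaTerm_natCast, ← pow_succ', ← pow_mul, ← pow_add]
        congr 1
        cases k with
        | zero => rfl
        | succ k =>
          have h2 := succ_choose_two_mul_two k
          zify at h2 ⊢
          rw [natCast_hexagonal]
          push_cast
          linarith
      · rw [thetaTerm_neg_natCast, ← pow_succ', ← pow_mul, ← pow_mul, ← pow_add]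
        congr 1
        cases k with
        | zero => rfl
        | succ k =>
          have h2 := succ_choose_two_mul_two k
          zify at h2 ⊢
          rw [natCast_hexagonal]
          push_cast
          linarith

theorem adicTendsto_pentSeries : AdicTendsto (fun n => ∏ i ∈ Finset.range n,
    ((1 + X ^ (3 * i + 1)) * (1 + X ^ (3 * i + 2)) * (1 - X ^ (3 * (i + 1))))) pentSeries := by
  have h := adicTendsto_tripleProduct (a := X) (b := X ^ 2) (S := pentSeries) (m := 3) (by decide)
    (by ring) ?_
  · refine h.congr fun n => Finset.prod_congr rfl fun i _ => ?_
    ring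
  · refine (adicTendsto_sum_Icc pentagonal_injective (F := pentSeries) ?_ ?_).congr
      fun n => Finset.sum_congr rfl fun j _ => ?_
    · intro j
      rw [pentSeries, coeff_mk, if_pos (isSquare_pentagonal j)]
    · intro d hd
      rw [pentSeries, coeff_mk, if_neg]
      exact fun hs => absurd (exists_pentagonal_eq hs) (by simpa using hd)
    · obtain ⟨k, rfl | rfl⟩ := j.eq_nat_or_neg
      · rw [thetaTerm_natCast, ← pow_succ', ← pow_mul, ← pow_add]
        congr 1
        have h3 := two_mul_natCast_pentagonal k
        cases k with
        | zero => rfl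
        | succ k =>
          have h2 := succ_choose_two_mul_two k
          zify at h2 ⊢
          push_cast at *
          linarith
      · rw [thetaTerm_neg_natCast, ← pow_succ', ← pow_mul, ← pow_mul, ← pow_add]
        congr 1
        have h3 := two_mul_natCast_pentagonal (-k)
        cases k with
        | zero => rfl
        | succ k =>
          have h2 := succ_choose_two_mul_two k
          zify at h2 ⊢
          push_cast at *
          linarith

theorem psiSeries_eq : psiSeries = oddDistinctSeries * eulerSeries 4 := by
  refine adicTendsto_psiSeries.unique
    (((adicTendsto_oddDistinctSeries.comp_mul (by decide : 0 < 4)).mul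
      (adicTendsto_eulerSeries 4)).congr fun n => ?_)
  rw [prod_range_mul, ← Finset.prod_mul_distrib]
  refine Finset.prod_congr rfl fun i _ => ?_
  simp only [Finset.prod_range_succ, Finset.prod_range_zero]
  rw [if_pos ⟨2 * i, by ring⟩, if_neg (by rw [Nat.not_odd_iff]; omega),
    if_pos ⟨2 * i + 1, by ring⟩, if_neg (by rw [Nat.not_odd_iff]; omega)]
  ring

theorem psiSeries_mul : psiSeries * eulerSeries 1 = eulerSeries 2 ^ 2 := by
  rw [psiSeries_eq]
  linear_combination oddDistinctSeries_mul

theorem tripleSeries_mul : tripleSeries * eulerSeries 4 ^ 3 = psiSeries ^ 2 := by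
  rw [tripleSeries_eq, psiSeries_eq]
  linear_combination oddDistinctSeries ^ 2 * eulerSeries 4 ^ 2 * fourDvdSeries_mul

/-- Multiplying `1 + q^k` by `1 - q^k` for `3 ∤ k` yields the factors of `f₂` prime to 3, and `f₆`
supplies the missing ones. -/
theorem pentSeries_mul :
    pentSeries * (eulerSeries 1 * eulerSeries 6) = eulerSeries 2 * eulerSeries 3 ^ 2 := by
  rw [pow_two]
  refine (adicTendsto_pentSeries.mul (((adicTendsto_eulerSeries 1).comp_mul
    (by decide : 0 < 3)).mul (adicTendsto_eulerSeries 6))).unique ?_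
  refine (((adicTendsto_eulerSeries 2).comp_mul (by decide : 0 < 3)).mul
    ((adicTendsto_eulerSeries 3).mul (adicTendsto_eulerSeries 3))).congr fun n => ?_
  simp_rw [prod_range_mul, ← Finset.prod_mul_distrib]
  refine Finset.prod_congr rfl fun i _ => ?_
  simp only [Finset.prod_range_succ, Finset.prod_range_zero]
  ring

/-- `ψ(-q)`. -/
noncomputable def psiNegSeries : ℤ⟦X⟧ := rescale (-1) psiSeries

theorem rescale_neg_one_X_pow (n : ℕ) :
    rescale (-1 : ℤ) (X ^ n) = C ((-1) ^ n) * X ^ n := by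
  rw [map_pow, rescale_X, mul_pow, map_pow]

theorem psiNegSeries_mul : psiNegSeries * eulerSeries 2 = eulerSeries 1 * eulerSeries 4 := by
  have h := adicTendsto_psiSeries.map (rescale (-1 : ℤ)) (by rw [rescale_X]; exact dvd_mul_left _ _)
  refine (h.mul ((adicTendsto_eulerSeries 2).comp_mul (by decide : 0 < 2))).unique ?_
  refine (((adicTendsto_eulerSeries 1).comp_mul (by decide : 0 < 4)).mul
    (adicTendsto_eulerSeries 4)).congr fun n => ?_
  simp_rw [prod_range_mul, map_prod, ← Finset.prod_mul_distrib]
  refine Finset.prod_congr rfl fun i _ => ?_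
  have h1 : ((-1 : ℤ)) ^ (4 * i + 1) = -1 := Odd.neg_one_pow ⟨2 * i, by ring⟩
  have h3 : ((-1 : ℤ)) ^ (4 * i + 3) = -1 := Odd.neg_one_pow ⟨2 * i + 1, by ring⟩
  have h4 : ((-1 : ℤ)) ^ (4 * (i + 1)) = 1 := Even.neg_one_pow ⟨2 * (i + 1), by ring⟩
  simp only [Finset.prod_range_succ, Finset.prod_range_zero, map_mul, map_add, map_sub, map_one,
    rescale_neg_one_X_pow, h1, h3, h4, map_neg]
  ring

end ThetaSeries

/-! ### Jacobi's identity for the cube, by dual numbers -/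

section Cube

theorem eight_mul_choose_add_one (i : ℕ) :
    8 * (i + 1).choose 2 + 1 = (2 * i + 1) * (2 * i + 1) := by
  linear_combination 4 * succ_choose_two_mul_two i

theorem succ_choose_two_injective : Function.Injective fun i : ℕ => (i + 1).choose 2 := by
  intro x y h
  have hx := eight_mul_choose_add_one x
  rw [show (x + 1).choose 2 = (y + 1).choose 2 from h, eight_mul_choose_add_one y] at hx
  have := Nat.mul_self_inj.1 hx
  omega

theorem exists_succ_choose_two_eq {d : ℕ} (h : IsSquare (8 * d + 1)) :
    ∃ i : ℕ, (i + 1).choose 2 = d := by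
  obtain ⟨s, hs⟩ := h
  have hodd : s % 2 = 1 := by
    by_contra h
    have h0 : s % 2 = 0 := by omega
    have := Nat.mul_mod s s 2
    rw [h0, ← hs] at this
    omega
  refine ⟨s / 2, ?_⟩
  have h1 := eight_mul_choose_add_one (s / 2)
  rw [show 2 * (s / 2) + 1 = s by omega] at h1
  omega

/-- Jacobi's series `∑ (-1) ^ k (2 k + 1) q ^ (k (k + 1) / 2)` over `k ≥ 0`. -/
noncomputable def cubeSeries : ℤ⟦X⟧ := PowerSeries.mk fun n =>
  if IsSquare (8 * n + 1) then (-1) ^ (Nat.sqrt (8 * n + 1) / 2) * (Nat.sqrt (8 * n + 1) : ℤ) else 0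

theorem coeff_cubeSeries_of_sq {n s : ℕ} (h : 8 * n + 1 = s * s) :
    coeff n cubeSeries = (-1) ^ (s / 2) * (s : ℤ) := by
  rw [cubeSeries, coeff_mk, if_pos ⟨s, h⟩, h, Nat.sqrt_eq]

theorem coeff_cubeSeries_eq_zero {n : ℕ} (h : ¬ IsSquare (8 * n + 1)) :
    coeff n cubeSeries = 0 := by
  rw [cubeSeries, coeff_mk, if_neg h]

theorem sum_Icc_neg_eq {M : Type*} [AddCommGroup M] (t : ℤ → M) (n : ℕ) :
    ∑ j ∈ Finset.Icc (-n : ℤ) n, t j = t n + ∑ i ∈ Finset.range n, (t i + t (-(i + 1 : ℕ))) := by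
  induction n with
  | zero => simp
  | succ n ih =>
    have : Finset.Icc (-(n + 1 : ℕ) : ℤ) (n + 1 : ℕ) =
        insert ((n + 1 : ℕ) : ℤ) (insert (-(n + 1 : ℕ) : ℤ) (Finset.Icc (-n : ℤ) n)) := by
      ext j
      simp only [Finset.mem_Icc, Finset.mem_insert]
      omega
    rw [this, Finset.sum_insert, Finset.sum_insert, ih, Finset.sum_range_succ]
    · abel
    · simp only [Finset.mem_Icc]
      omega
    · simp only [Finset.mem_Icc, Finset.mem_insert]
      omega

variable {K : Type*} [CommRing K] {e : K}

theorem one_add_pow_of_mul_self_eq_zero (he : e * e = 0) (k : ℕ) : (1 + e) ^ k = 1 + k * e := by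
  induction k with
  | zero => simp
  | succ k ih =>
    rw [pow_succ, ih]
    push_cast
    linear_combination (k : K) * he

theorem C_one_add_mul_C_one_sub (he : e * e = 0) : C (1 + e) * C (1 - e) = 1 := by
  rw [← map_mul, ← map_one C]
  congr 1
  linear_combination -he

theorem C_mul_prod {ι : Type*} (s : Finset ι) {f g : ι → K⟦X⟧}
    (h : ∀ i, C e * f i = C e * g i) : C e * ∏ i ∈ s, f i = C e * ∏ i ∈ s, g i := by
  classical
  induction s using Finset.induction_on with
  | empty => simp
  | insert i s hi ih =>
    rw [Finset.prod_insert hi, Finset.prod_insert hi]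
    linear_combination (∏ i ∈ s, f i) * h i + g i * ih

/-- Jacobi's identity is the first-order part of the triple product at `z = 1`. The infinitesimal
`e` replaces differentiation in `z`: at order zero the terms `i` and `-(i + 1)` cancel, at order one
they add up to `(-1)^i (2i + 1)`. -/
theorem adicTendsto_sum_thetaTerm_cube (he : e * e = 0) :
    AdicTendsto (fun n : ℕ => ∑ j ∈ Finset.Icc (-n : ℤ) n,
      thetaTerm (-C (1 + e) * X) (-C (1 - e)) j) (C e * PowerSeries.map (Int.castRingHom K) cubeSeries) := by
  set a : K⟦X⟧ := -C (1 + e) * X with ha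
  set b : K⟦X⟧ := -C (1 - e) with hb
  have hab : a * b = X := by
    rw [ha, hb]
    linear_combination X * C_one_add_mul_C_one_sub he
  have hpos (k : ℕ) : thetaTerm a b k = C ((-1) ^ k * (1 + k * e)) * X ^ (k + 1).choose 2 := by
    rw [thetaTerm_natCast, hab, ha, mul_pow, neg_pow, ← map_pow,
      one_add_pow_of_mul_self_eq_zero he, Nat.choose_succ_succ' k 1, Nat.choose_one_right,
      map_mul C, map_pow C (-1), map_neg C, map_one C]
    ring
  have hneg (k : ℕ) : thetaTerm a b (-(k : ℕ)) = C ((-1) ^ k * (1 - k * e)) * X ^ k.choose 2 := by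
    rw [thetaTerm_neg_natCast, hab, hb, neg_pow, ← map_pow, sub_eq_add_neg 1 e,
      one_add_pow_of_mul_self_eq_zero (e := -e) (by rw [neg_mul_neg, he]), mul_neg,
      ← sub_eq_add_neg, map_mul C, map_pow C (-1), map_neg C, map_one C]
    ring
  have hpair (i : ℕ) : thetaTerm a b i + thetaTerm a b (-(i + 1 : ℕ)) =
      C (e * Int.castRingHom K ((-1) ^ i * (2 * i + 1 : ℕ))) * X ^ (i + 1).choose 2 := by
    rw [hpos, hneg, ← add_mul, ← map_add]
    congr 2
    simp only [map_mul, map_pow, map_neg, map_one, map_natCast]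
    push_cast
    ring
  refine AdicTendsto.of_coeff fun d => ?_
  simp_rw [sum_Icc_neg_eq, hpair, map_add, map_sum, hpos, coeff_C_mul, coeff_X_pow, coeff_map]
  filter_upwards [eventually_gt_atTop (d + 1)] with n hn
  -- The unpaired term at `j = n` has exponent `n(n + 1)/2 > d`.
  rw [if_neg (by
    have := succ_choose_two_mul_two n
    nlinarith), mul_zero, zero_add]
  by_cases hd : IsSquare (8 * d + 1)
  · obtain ⟨i, rfl⟩ := exists_succ_choose_two_eq hd
    rw [Finset.sum_eq_single i, if_pos rfl, coeff_cubeSeries_of_sq (eight_mul_choose_add_one i),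
      show (2 * i + 1) / 2 = i by omega, mul_one]
    · intro j _ hj
      rw [if_neg fun h => hj (succ_choose_two_injective h).symm, mul_zero]
    · intro hi
      rw [Finset.mem_range, not_lt] at hi
      have := succ_choose_two_mul_two i
      nlinarith
  · rw [coeff_cubeSeries_eq_zero hd, map_zero, mul_zero, Finset.sum_eq_zero]
    intro j _
    rw [if_neg, mul_zero]
    rintro rfl
    exact hd ⟨_, eight_mul_choose_add_one j⟩

theorem C_mul_map_cubeSeries (he : e * e = 0) :
    C e * PowerSeries.map (Int.castRingHom K) cubeSeries =
      C e * PowerSeries.map (Int.castRingHom K) (eulerSeries 1 ^ 3) := by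
  have h := adicTendsto_tripleProduct (m := 1) one_pos
    (by linear_combination X * C_one_add_mul_C_one_sub he) (adicTendsto_sum_thetaTerm_cube he)
  refine (h.comp (tendsto_add_atTop_nat 1)).unique ?_
  have hf := (adicTendsto_eulerSeries 1).map (PowerSeries.map (Int.castRingHom K)) (by simp)
  have hc : AdicTendsto (fun _ : ℕ => C e) (C e) := fun d => by simp
  rw [map_pow, pow_three]
  refine (hc.mul ((hf.comp (tendsto_add_atTop_nat 1)).mul
    (hf.mul (hf.comp (tendsto_add_atTop_nat 1))))).congr fun n => ?_
  have hC : C e * C e = 0 := by rw [← map_mul, he, map_zero]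
  simp only [map_prod, map_sub (PowerSeries.map (Int.castRingHom K)), map_one (PowerSeries.map (Int.castRingHom K)),
    map_pow, map_X, one_mul]
  rw [Finset.prod_mul_distrib, Finset.prod_mul_distrib,
    Finset.prod_range_succ' (fun i => 1 + -C (1 - e) * X ^ i)]
  have h1 := C_mul_prod (e := e) (Finset.range (n + 1))
    (f := fun i => 1 + -C (1 + e) * X * X ^ i) (g := fun i => 1 - X ^ (i + 1)) fun i => by
      rw [map_add, map_one]
      linear_combination -X ^ (i + 1) * hC
  have h2 := C_mul_prod (e := e) (Finset.range n)
    (f := fun i => 1 + -C (1 - e) * X ^ (i + 1)) (g := fun i => 1 - X ^ (i + 1)) fun i => by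
      rw [map_sub, map_one]
      linear_combination X ^ (i + 1) * hC
  -- The first factor in `b` is `e` itself. Because `e² = 0`, it lets `e` be replaced by 0 in all
  -- other factors, leaving three Euler products; the index shift by one accounts for the factor
  -- split off.
  have h3 : 1 + -C (1 - e) * X ^ 0 = C e := by
    rw [map_sub, map_one]
    ring
  rw [h3]
  linear_combination -(∏ i ∈ Finset.range (n + 1), (1 - X ^ (i + 1))) *
    (∏ i ∈ Finset.range n, (1 - X ^ (i + 1))) * h1 - (∏ i ∈ Finset.range (n + 1),
    (1 + -C (1 + e) * X * X ^ i)) * (∏ i ∈ Finset.range (n + 1), (1 - X ^ (i + 1))) * h2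

/-- Jacobi's identity for the cube of the Euler product. -/
theorem cubeSeries_eq : cubeSeries = eulerSeries 1 ^ 3 := by
  ext d
  -- For the dual number `ε`, the `ε`-component of `ε · x` with `x` an integer is `x`, so the factor
  -- can be removed.
  have h := congrArg (fun S => (coeff d S).snd)
    (C_mul_map_cubeSeries (e := (DualNumber.eps : DualNumber ℤ)) DualNumber.eps_mul_eps)
  simpa [coeff_C_mul, -map_pow] using h

end Cube

/-! ### 3-dissections and the derivation `θ` -/

section Dissection

/-- The series `∑ a (3 n + 1) q ^ n` for `F = ∑ a n q ^ n`. -/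
noncomputable def sectionOne (F : ℤ⟦X⟧) : ℤ⟦X⟧ := PowerSeries.mk fun n => coeff (3 * n + 1) F

theorem coeff_dilate (m : ℕ) [NeZero m] (F : ℤ⟦X⟧) (n : ℕ) :
    coeff n (dilate m F) = if m ∣ n then coeff (n / m) F else 0 := coeff_expand _ _ _

theorem coeff_dissection (a b c : ℤ⟦X⟧) (n : ℕ) :
    coeff (3 * n) (dilate 3 a + X * dilate 3 b + X ^ 2 * dilate 3 c) = coeff n a ∧
    coeff (3 * n + 1) (dilate 3 a + X * dilate 3 b + X ^ 2 * dilate 3 c) = coeff n b ∧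
    coeff (3 * n + 2) (dilate 3 a + X * dilate 3 b + X ^ 2 * dilate 3 c) = coeff n c := by
  have hX : X * dilate 3 b = X ^ 1 * dilate 3 b := by rw [pow_one]
  simp only [hX, map_add, coeff_X_pow_mul', coeff_dilate]
  refine ⟨?_, ?_, ?_⟩
  · rw [if_pos (by omega)]
    have h1 : (if 1 ≤ 3 * n then if 3 ∣ 3 * n - 1 then coeff ((3 * n - 1) / 3) b else 0 else 0)
        = 0 := by
      split_ifs <;> first | rfl | omega
    have h2 : (if 2 ≤ 3 * n then
        if 3 ∣ 3 * n - 2 then coeff ((3 * n - 2) / 3) c else 0 else 0) = 0 := by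
      split_ifs <;> first | rfl | omega
    rw [h1, h2, Nat.mul_div_cancel_left _ (by decide), add_zero, add_zero]
  · rw [if_neg (by omega), if_pos (by omega), if_pos (by omega)]
    have h2 : (if 2 ≤ 3 * n + 1 then
        if 3 ∣ 3 * n + 1 - 2 then coeff ((3 * n + 1 - 2) / 3) c else 0 else 0) = 0 := by
      split_ifs <;> first | rfl | omega
    rw [h2, show (3 * n + 1 - 1) / 3 = n by omega, zero_add, add_zero]
  · rw [if_neg (by omega), if_pos (by omega), if_neg (by omega), if_pos (by omega),
      if_pos (by omega), show (3 * n + 2 - 2) / 3 = n by omega, zero_add, zero_add]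

theorem sectionOne_dissection (a b c : ℤ⟦X⟧) :
    sectionOne (dilate 3 a + X * dilate 3 b + X ^ 2 * dilate 3 c) = b := by
  ext n
  rw [sectionOne, coeff_mk, (coeff_dissection a b c n).2.1]

theorem eq_dissection {F a b c : ℤ⟦X⟧} (ha : ∀ n, coeff (3 * n) F = coeff n a)
    (hb : ∀ n, coeff (3 * n + 1) F = coeff n b) (hc : ∀ n, coeff (3 * n + 2) F = coeff n c) :
    F = dilate 3 a + X * dilate 3 b + X ^ 2 * dilate 3 c := by
  ext n
  obtain h | h | h : n = 3 * (n / 3) ∨ n = 3 * (n / 3) + 1 ∨ n = 3 * (n / 3) + 2 := by omega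
  all_goals
    rw [h]
    generalize n / 3 = k
    first
      | rw [ha, (coeff_dissection a b c k).1]
      | rw [hb, (coeff_dissection a b c k).2.1]
      | rw [hc, (coeff_dissection a b c k).2.2]

theorem sectionOne_dilate_mul (G F : ℤ⟦X⟧) : sectionOne (dilate 3 G * F) = G * sectionOne F := by
  have h := eq_dissection (F := F) (a := PowerSeries.mk fun n => coeff (3 * n) F)
    (b := sectionOne F) (c := PowerSeries.mk fun n => coeff (3 * n + 2) F)
    (fun n => by rw [coeff_mk]) (fun n => by rw [sectionOne, coeff_mk])
    (fun n => by rw [coeff_mk])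
  have h2 : dilate 3 G * F = dilate 3 (G * PowerSeries.mk fun n => coeff (3 * n) F) +
      X * dilate 3 (G * sectionOne F) +
      X ^ 2 * dilate 3 (G * PowerSeries.mk fun n => coeff (3 * n + 2) F) := by
    conv_lhs => rw [h]
    simp only [map_mul]
    ring
  rw [h2, sectionOne_dissection]

theorem sectionOne_add (F G : ℤ⟦X⟧) : sectionOne (F + G) = sectionOne F + sectionOne G := by
  ext n
  simp [sectionOne]

theorem isSquare_mul_nine_iff (n : ℕ) : IsSquare (9 * n) ↔ IsSquare n := by
  constructor
  · rintro ⟨s, hs⟩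
    have h3 : 3 ∣ s := by
      have : 3 ∣ s * s := ⟨3 * n, by rw [← hs]; ring⟩
      exact (Nat.prime_three.dvd_mul.1 this).elim id id
    obtain ⟨t, rfl⟩ := h3
    exact ⟨t, by nlinarith⟩
  · rintro ⟨s, rfl⟩
    exact ⟨3 * s, by ring⟩

theorem three_dvd_of_isSquare {n : ℕ} (h : IsSquare (8 * (3 * n + 1) + 1)) : 3 ∣ n := by
  obtain ⟨s, hs⟩ := h
  have h3 : 3 ∣ s := by
    have : 3 ∣ s * s := ⟨8 * n + 3, by rw [← hs]; ring⟩
    exact (Nat.prime_three.dvd_mul.1 this).elim id id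
  obtain ⟨t, rfl⟩ := h3
  have : 3 * (t * t) = 8 * n + 3 := by nlinarith
  omega

theorem not_isSquare_two_mod (n : ℕ) : ¬ IsSquare (8 * (3 * n + 2) + 1) := by
  rintro ⟨s, hs⟩
  have h : (s % 3) * (s % 3) % 3 = 2 := by
    rw [← Nat.mul_mod, ← hs]
    omega
  have : s % 3 < 3 := Nat.mod_lt _ (by decide)
  generalize s % 3 = r at *
  interval_cases r <;> simp_all

/-- A triangular exponent `m` means `8m + 1` is a square. For `m = 3n` this is the pentagonal
condition on `n`; for `m = 3n + 1` the square is divisible by 3, hence by 9, which gives `m = 9k +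
1` with `k` triangular; `m = 3n + 2` would give a square that is 2 mod 3. -/
theorem psiSeries_dissection :
    psiSeries = dilate 3 pentSeries + X * dilate 3 (dilate 3 psiSeries) := by
  have h := eq_dissection (F := psiSeries) (a := pentSeries) (b := dilate 3 psiSeries) (c := 0)
    (fun n => ?_) (fun n => ?_) (fun n => ?_)
  · simpa using h
  · rw [psiSeries, pentSeries, coeff_mk, coeff_mk, show 8 * (3 * n) + 1 = 24 * n + 1 by ring]
  · rw [coeff_dilate]
    split_ifs with h3
    · obtain ⟨k, rfl⟩ := h3
      rw [Nat.mul_div_cancel_left _ (by decide), psiSeries, coeff_mk, coeff_mk,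
        show 8 * (3 * (3 * k) + 1) + 1 = 9 * (8 * k + 1) by ring]
      simp only [isSquare_mul_nine_iff]
    · rw [psiSeries, coeff_mk, if_neg fun h => h3 (three_dvd_of_isSquare h)]
  · rw [psiSeries, coeff_mk, if_neg (not_isSquare_two_mod n), map_zero]

/-- The series `∑ (-1) ^ k (6 k + 1) q ^ (k (3 k + 1) / 2)` over the integers `k`. -/
noncomputable def cubeSection : ℤ⟦X⟧ := PowerSeries.mk fun n => coeff (3 * n) cubeSeries

/-- As for `ψ`, but passing from exponent `k` to `9k + 1` triples the odd root `2i + 1` and flips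
the sign, since `(6i + 3) / 2 = 3i + 1`; hence the factor `-3`. -/
theorem cubeSeries_dissection :
    cubeSeries = dilate 3 cubeSection - 3 * X * dilate 3 (dilate 3 cubeSeries) := by
  have h := eq_dissection (F := cubeSeries) (a := cubeSection) (b := -3 * dilate 3 cubeSeries)
    (c := 0) (fun n => ?_) (fun n => ?_) (fun n => ?_)
  · rw [map_zero, mul_zero, add_zero, map_mul, map_neg, map_ofNat] at h
    linear_combination h
  · rw [cubeSection, coeff_mk]
  · have h3 : (-3 : ℤ⟦X⟧) = C (-3) := by simp
    rw [h3, coeff_C_mul, coeff_dilate]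
    split_ifs with h3
    · obtain ⟨k, rfl⟩ := h3
      rw [Nat.mul_div_cancel_left _ (by decide)]
      by_cases hk : IsSquare (8 * k + 1)
      · obtain ⟨i, rfl⟩ := exists_succ_choose_two_eq hk
        have hs := eight_mul_choose_add_one i
        rw [coeff_cubeSeries_of_sq hs, coeff_cubeSeries_of_sq (s := 3 * (2 * i + 1)) (by
          linear_combination 9 * hs), show (2 * i + 1) / 2 = i by omega,
          show 3 * (2 * i + 1) / 2 = 2 * i + (i + 1) by omega, pow_add, pow_mul]
        push_cast
        ring
      · rw [coeff_cubeSeries_eq_zero hk, coeff_cubeSeries_eq_zero, mul_zero]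
        rwa [show 8 * (3 * (3 * k) + 1) + 1 = 9 * (8 * k + 1) by ring, isSquare_mul_nine_iff]
    · rw [coeff_cubeSeries_eq_zero fun h => h3 (three_dvd_of_isSquare h), mul_zero]
  · rw [coeff_cubeSeries_eq_zero (not_isSquare_two_mod n), map_zero]

/-- The derivation `q d/dq`. -/
noncomputable def theta (F : ℤ⟦X⟧) : ℤ⟦X⟧ := X * derivative ℤ F

theorem coeff_theta (F : ℤ⟦X⟧) (n : ℕ) : coeff n (theta F) = n * coeff n F := by
  rw [theta]
  cases n with
  | zero => simp
  | succ n =>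
    rw [coeff_succ_X_mul, coeff_derivative]
    push_cast
    ring

theorem theta_add (F G : ℤ⟦X⟧) : theta (F + G) = theta F + theta G := by
  rw [theta, theta, theta, map_add, mul_add]

theorem theta_mul (F G : ℤ⟦X⟧) : theta (F * G) = theta F * G + F * theta G := by
  rw [theta, theta, theta, Derivation.leibniz, smul_eq_mul, smul_eq_mul]
  ring

theorem theta_dilate (m : ℕ) [NeZero m] (F : ℤ⟦X⟧) :
    theta (dilate m F) = m * dilate m (theta F) := by
  ext n
  rw [← map_natCast (C (R := ℤ)), coeff_C_mul, coeff_theta, coeff_dilate, coeff_dilate]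
  split_ifs with h
  · obtain ⟨k, rfl⟩ := h
    rw [Nat.mul_div_cancel_left _ (Nat.pos_of_neZero m), coeff_theta]
    push_cast
    ring
  · simp

theorem intCast_dvd_iff {k : ℤ} {F : ℤ⟦X⟧} : (k : ℤ⟦X⟧) ∣ F ↔ ∀ n, k ∣ coeff n F := by
  rw [← map_intCast (C (R := ℤ)), Int.cast_id]
  constructor
  · rintro ⟨G, rfl⟩ n
    rw [coeff_C_mul]
    exact dvd_mul_right _ _
  · intro h
    choose g hg using h
    exact ⟨PowerSeries.mk g, by ext n; rw [coeff_C_mul, coeff_mk, hg]⟩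

/-- At the pentagonal exponent `g = j(3j - 1)/2` the coefficients are `(-1)^j (1 - 6j)` and `(-1)^j
(1 + 3g)`. They agree mod 9 because `g ≡ j` mod 3. -/
theorem cubeSection_congr :
    (9 : ℤ⟦X⟧) ∣ cubeSection - (eulerSeries 1 + 3 * theta (eulerSeries 1)) := by
  have : (9 : ℤ⟦X⟧) = ((9 : ℤ) : ℤ⟦X⟧) := by norm_num
  rw [this, intCast_dvd_iff]
  intro n
  have h3 : (3 : ℤ⟦X⟧) = C 3 := by simp
  rw [map_sub, map_add, h3, coeff_C_mul, coeff_theta, cubeSection, coeff_mk, eulerSeries_one]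
  by_cases hn : IsSquare (24 * n + 1)
  · obtain ⟨j, rfl⟩ := exists_pentagonal_eq hn
    have hc : coeff (3 * pentagonal j) cubeSeries = (j.negOnePow : ℤ) * (1 - 6 * j) := by
      rw [coeff_cubeSeries_of_sq (s := (6 * j - 1).natAbs) (by rw [← pentagonal_sq]; ring)]
      rcases le_or_gt j 0 with h | h
      · obtain ⟨k, rfl⟩ := Int.exists_eq_neg_ofNat h
        rw [show (6 * -(k : ℤ) - 1).natAbs = 6 * k + 1 by omega,
          show (6 * k + 1) / 2 = k + 2 * k by omega, Int.negOnePow_neg, Int.negOnePow_def]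
        simp [pow_add, pow_mul]
        ring
      · obtain ⟨k, rfl⟩ : ∃ k : ℕ, j = k + 1 := ⟨(j - 1).toNat, by omega⟩
        rw [show (6 * ((k : ℤ) + 1) - 1).natAbs = 6 * k + 5 by omega,
          show (6 * k + 5) / 2 = k + 2 * (k + 1) by omega, Int.negOnePow_succ, Int.negOnePow_def]
        simp [pow_add, pow_mul]
        ring
    rw [hc, coeff_pentagonalSeries_pentagonal, Int.cast_id]
    have h2 := two_mul_natCast_pentagonal j
    obtain ⟨c, hc⟩ : (3 : ℤ) ∣ pentagonal j + 2 * j := by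
      generalize (pentagonal j : ℤ) = p at *
      obtain ⟨q, hq⟩ : ∃ q, q = j * j := ⟨_, rfl⟩
      have : 2 * p = 3 * q - j := by rw [hq]; linarith
      omega
    exact ⟨-(j.negOnePow : ℤ) * c, by linear_combination -3 * (j.negOnePow : ℤ) * hc⟩
  · rw [coeff_cubeSeries_eq_zero (by rwa [← mul_assoc]), coeff_pentagonalSeries_eq_zero]
    · simp
    · rintro ⟨j, rfl⟩
      exact hn (isSquare_pentagonal j)

end Dissection

/-! ### The congruence mod 9 for the exponents `3M + 1` -/

section Congruence

theorem pow_three_congr_dilate (F : ℤ⟦X⟧) : (3 : ℤ⟦X⟧) ∣ F ^ 3 - dilate 3 F := by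
  have h3 : (3 : ℤ⟦X⟧) = ((3 : ℤ) : ℤ⟦X⟧) := by norm_num
  rw [h3, intCast_dvd_iff]
  intro n
  have h := MvPowerSeries.map_frobenius_expand 3 three_ne_zero
    (f := PowerSeries.map (Int.castRingHom (ZMod 3)) F)
  rw [ZMod.frobenius_zmod, MvPowerSeries.map_id, RingHom.id_apply] at h
  have h2 : PowerSeries.map (Int.castRingHom (ZMod 3)) (F ^ 3 - dilate 3 F) = 0 := by
    rw [map_sub, map_pow, dilate, PowerSeries.map_expand, sub_eq_zero]
    exact h.symm
  have h4 := congrArg (coeff n) h2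
  rw [coeff_map, map_zero, eq_intCast, ZMod.intCast_zmod_eq_zero_iff_dvd] at h4
  exact_mod_cast h4

theorem isUnit_eulerSeries (m : ℕ) [NeZero m] : IsUnit (eulerSeries m) := by
  rw [PowerSeries.isUnit_iff_constantCoeff, constantCoeff_eulerSeries]
  exact isUnit_one

theorem pentSeries_mul_psiNegSeries :
    pentSeries * psiNegSeries * eulerSeries 6 = eulerSeries 4 * eulerSeries 3 ^ 2 := by
  refine mul_right_cancel₀ (mul_ne_zero (eulerSeries_ne_zero 1) (eulerSeries_ne_zero 2)) ?_
  linear_combination psiNegSeries * eulerSeries 2 * pentSeries_mul +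
    eulerSeries 2 * eulerSeries 3 ^ 2 * psiNegSeries_mul

theorem dilate_psiSeries_mul :
    eulerSeries 6 * dilate 3 psiSeries * dilate 3 psiNegSeries ^ 3 =
      eulerSeries 3 ^ 2 * eulerSeries 12 ^ 3 := by
  have h1 := congrArg (dilate 3) psiSeries_mul
  have h2 := congrArg (dilate 3) psiNegSeries_mul
  rw [map_mul, map_pow, dilate_eulerSeries (by rfl : 3 * 1 = 3),
    dilate_eulerSeries (by rfl : 3 * 2 = 6)] at h1
  rw [map_mul, map_mul, dilate_eulerSeries (by rfl : 3 * 1 = 3),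
    dilate_eulerSeries (by rfl : 3 * 2 = 6), dilate_eulerSeries (by rfl : 3 * 4 = 12)] at h2
  have h3 : dilate 3 psiNegSeries ^ 3 * eulerSeries 6 ^ 3 =
      eulerSeries 3 ^ 3 * eulerSeries 12 ^ 3 := by
    rw [← mul_pow, h2, mul_pow]
  refine mul_right_cancel₀ (mul_ne_zero (eulerSeries_ne_zero 3)
    (pow_ne_zero 3 (eulerSeries_ne_zero 6))) ?_
  linear_combination eulerSeries 6 * dilate 3 psiNegSeries ^ 3 * eulerSeries 6 ^ 3 * h1 +
    eulerSeries 6 ^ 3 * h3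

theorem rescale_dilate_three (F : ℤ⟦X⟧) :
    rescale (-1) (dilate 3 F) = dilate 3 (rescale (-1) F) := by
  ext n
  rw [coeff_rescale, coeff_dilate, coeff_dilate]
  split_ifs with h
  · obtain ⟨k, rfl⟩ := h
    rw [Nat.mul_div_cancel_left _ (by decide), coeff_rescale, pow_mul]
    norm_num
  · rw [mul_zero]

theorem psiNegSeries_dissection :
    psiNegSeries = dilate 3 (rescale (-1) pentSeries) -
      X * dilate 3 (dilate 3 psiNegSeries) := by
  have h := congrArg (rescale (-1 : ℤ)) psiSeries_dissection
  rw [map_add, map_mul, rescale_X, rescale_dilate_three, rescale_dilate_three,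
    rescale_dilate_three, map_neg, map_one] at h
  rw [psiNegSeries]
  linear_combination h

theorem three_dvd_theta_dilate (F : ℤ⟦X⟧) : (3 : ℤ⟦X⟧) ∣ theta (dilate 3 F) := by
  rw [theta_dilate]
  exact Dvd.intro _ rfl

/-- Mod 3, `θ` kills series in `q³`, so only the factor `q` of `-qψ(-q⁹)` is differentiated; then
`ψ(-q⁹) ≡ ψ(-q³)³`. -/
theorem theta_psiNegSeries_congr :
    (3 : ℤ⟦X⟧) ∣ theta psiNegSeries + X * dilate 3 psiNegSeries ^ 3 := by
  have h := congrArg theta psiNegSeries_dissection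
  rw [sub_eq_add_neg, ← neg_mul, theta_add, theta_mul] at h
  have hX : theta (-X) = -X := by rw [theta, map_neg, derivative_X]; ring
  obtain ⟨u, hu⟩ := three_dvd_theta_dilate (rescale (-1) pentSeries)
  obtain ⟨v, hv⟩ := three_dvd_theta_dilate (dilate 3 psiNegSeries)
  obtain ⟨w, hw⟩ := pow_three_congr_dilate (dilate 3 psiNegSeries)
  rw [hX, hu, hv] at h
  exact ⟨u - X * v + X * w, by linear_combination h + X * hw⟩

/-- Apply `θ` to `A(q) ψ(-q) f₆ = f₄ f₃²`: mod 3 the series `f₃` and `f₆` behave as constants, and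
`θψ(-q)` is known. `dilate_psiSeries_mul` then removes `ψ(-q³)³`, and the unit `f₃²` is cancelled.
-/
theorem theta_eulerSeries_four_congr :
    (3 : ℤ⟦X⟧) ∣ pentSeries * dilate 3 psiSeries * theta (eulerSeries 4) +
      X * pentSeries ^ 2 * eulerSeries 12 ^ 3 -
      eulerSeries 4 * dilate 3 psiSeries * theta pentSeries := by
  rw [← ((isUnit_eulerSeries 3).pow 2).dvd_mul_left]
  have h := congrArg theta pentSeries_mul_psiNegSeries
  rw [theta_mul, theta_mul, theta_mul, pow_two, theta_mul] at h
  obtain ⟨u, hu⟩ := three_dvd_theta_dilate (eulerSeries 2)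
  obtain ⟨v, hv⟩ := three_dvd_theta_dilate (eulerSeries 1)
  obtain ⟨w, hw⟩ := theta_psiNegSeries_congr
  rw [dilate_eulerSeries (by rfl : 3 * 2 = 6)] at hu
  rw [dilate_eulerSeries (by rfl : 3 * 1 = 3)] at hv
  rw [hu, hv] at h
  refine ⟨pentSeries * dilate 3 psiSeries * (pentSeries * w * eulerSeries 6 +
    pentSeries * psiNegSeries * u - 2 * eulerSeries 4 * eulerSeries 3 * v), ?_⟩
  linear_combination -pentSeries * dilate 3 psiSeries * h +
    pentSeries ^ 2 * dilate 3 psiSeries * eulerSeries 6 * hw +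
    dilate 3 psiSeries * theta pentSeries * pentSeries_mul_psiNegSeries -
    X * pentSeries ^ 2 * dilate_psiSeries_mul

/-- Cubing `f₄³ ≡ f₁₂` mod 3 lifts it to `f₄⁹ ≡ f₁₂³` mod 9. The factor `f₁₂²` is kept because, as a
series in `q³`, it passes through `sectionOne`. -/
theorem tripleSeries_congr :
    (9 : ℤ⟦X⟧) ∣ eulerSeries 12 * tripleSeries * eulerSeries 12 ^ 2 -
      eulerSeries 4 ^ 6 * psiSeries ^ 2 := by
  rw [← (isUnit_eulerSeries 12).dvd_mul_left]
  obtain ⟨k, hk⟩ := pow_three_congr_dilate (eulerSeries 4)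
  rw [dilate_eulerSeries (by rfl : 3 * 4 = 12)] at hk
  have h9 : eulerSeries 4 ^ 9 - eulerSeries 12 ^ 3 =
      9 * (eulerSeries 12 ^ 2 * k + 3 * eulerSeries 12 * k ^ 2 + 3 * k ^ 3) := by
    have : eulerSeries 4 ^ 3 = eulerSeries 12 + 3 * k := by linear_combination hk
    rw [show eulerSeries 4 ^ 9 = (eulerSeries 4 ^ 3) ^ 3 by ring, this]
    ring
  refine ⟨-eulerSeries 12 * tripleSeries *
    (eulerSeries 12 ^ 2 * k + 3 * eulerSeries 12 * k ^ 2 + 3 * k ^ 3), ?_⟩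
  linear_combination eulerSeries 12 * eulerSeries 4 ^ 6 * tripleSeries_mul -
    eulerSeries 12 * tripleSeries * h9

theorem eulerSeries_four_pow_three :
    eulerSeries 4 ^ 3 = dilate 3 (dilate 4 cubeSection) -
      3 * X ^ 4 * dilate 3 (eulerSeries 12 ^ 3) := by
  have h := congrArg (dilate 4) cubeSeries_dissection
  rw [map_sub, map_mul, map_mul, map_ofNat, dilate_X,
    dilate_dilate (by rfl : 4 * 3 = 12) cubeSection,
    ← dilate_dilate (by rfl : 3 * 4 = 12) cubeSection,
    dilate_dilate (by rfl : 4 * 3 = 12), dilate_dilate (by rfl : 12 * 3 = 36),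
    ← dilate_dilate (by rfl : 3 * 12 = 36), cubeSeries_eq, map_pow, map_pow (dilate 12),
    dilate_eulerSeries (by rfl : 4 * 1 = 4), dilate_eulerSeries (by rfl : 12 * 1 = 12)] at h
  exact h

/-- Substituting `q⁴` turns `θf₁` into `θf₄ / 4`; the 4 is harmless since `3 · 4 ≡ 3` mod 9. -/
theorem dilate_cubeSection_congr :
    (9 : ℤ⟦X⟧) ∣ dilate 4 cubeSection - (eulerSeries 4 + 3 * theta (eulerSeries 4)) := by
  obtain ⟨g, hg⟩ := cubeSection_congr
  have h := congrArg (dilate 4) hg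
  rw [map_sub, map_add, map_mul, map_mul, map_ofNat, map_ofNat,
    dilate_eulerSeries (by rfl : 4 * 1 = 4)] at h
  have h4 := theta_dilate 4 (eulerSeries 1)
  rw [dilate_eulerSeries (by rfl : 4 * 1 = 4)] at h4
  push_cast at h4
  exact ⟨dilate 4 g - dilate 4 (theta (eulerSeries 1)), by linear_combination h - 3 * h4⟩

theorem sectionOne_tripleSeries_congr :
    (9 : ℤ⟦X⟧) ∣ sectionOne (eulerSeries 12 * tripleSeries) -
      (2 * (pentSeries * dilate 3 psiSeries) + 3 * theta (pentSeries * dilate 3 psiSeries)) := by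
  rw [← ((isUnit_eulerSeries 4).pow 2).dvd_mul_left]
  obtain ⟨W, hW⟩ := tripleSeries_congr
  obtain ⟨g, hg⟩ := dilate_cubeSection_congr
  obtain ⟨y, hy⟩ := theta_eulerSeries_four_congr
  obtain ⟨z, hz⟩ := three_dvd_theta_dilate psiSeries
  have hF := eulerSeries_four_pow_three
  have hψ := psiSeries_dissection
  set A := pentSeries
  set f := eulerSeries 4
  set c := eulerSeries 12 ^ 3
  set P := dilate 4 cubeSection
  set ψ := dilate 3 psiSeries
  set S := eulerSeries 12 * tripleSeries
  have h12 : eulerSeries 12 = dilate 3 f := (dilate_eulerSeries (by rfl : 3 * 4 = 12)).symm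
  have hX : (X : ℤ⟦X⟧) ^ 3 = dilate 3 X := (dilate_X 3).symm
  -- Expansion of `(P(q³) - 3q⁴c(q³))² (A(q³) + qψ)²`, sorted by exponent mod 3, where `ψ` already
  -- denotes the dilated series; the square of `3q⁴c` joins the multiples of 9.
  have hS : dilate 3 (f ^ 2) * S = (dilate 3 (P ^ 2 * A ^ 2 - 6 * X ^ 2 * P * c * ψ ^ 2) +
      X * dilate 3 (2 * P ^ 2 * A * ψ - 6 * X * P * c * A ^ 2) +
      X ^ 2 * dilate 3 (P ^ 2 * ψ ^ 2 - 12 * X * P * c * A * ψ)) +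
      dilate 3 9 * (X ^ 8 * dilate 3 c ^ 2 * psiSeries ^ 2 + W) := by
    simp only [map_mul, map_sub, map_pow, map_ofNat, ← hX]
    rw [← h12]
    have h6 : f ^ 6 = (dilate 3 P - 3 * X ^ 4 * dilate 3 c) ^ 2 := by rw [← hF]; ring
    rw [h6] at hW
    have hψ2 : psiSeries ^ 2 = (dilate 3 A + X * dilate 3 ψ) ^ 2 := by rw [← hψ]
    linear_combination hW + (dilate 3 P ^ 2 - 6 * X ^ 4 * dilate 3 P * dilate 3 c) * hψ2
  have hU := congrArg sectionOne hS
  rw [sectionOne_add, sectionOne_dissection, sectionOne_dilate_mul, sectionOne_dilate_mul] at hU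
  generalize sectionOne (X ^ 8 * dilate 3 c ^ 2 * psiSeries ^ 2 + W) = V at hU
  have hP : P = f + 3 * theta f + 9 * g := by linear_combination hg
  rw [hP] at hU
  rw [theta_mul, hz]
  refine ⟨V + 2 * A * ψ * (theta f ^ 2 + 9 * g ^ 2 + 2 * f * g + 6 * theta f * g) -
    6 * X * c * A ^ 2 * g - 2 * X * c * A ^ 2 * theta f + f * theta f * A * ψ - X * f * c * A ^ 2 +
    f * y - f ^ 2 * A * z, ?_⟩
  -- Inserting `P ≡ f + 3θf` leaves `2f²Aψ + 3f(Aψ θf + q c A²)` mod 9, and `hy` turns the bracket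
  -- into `fψ θA` mod 3.
  linear_combination hU + 3 * f * hy

end Congruence

/-! ### Sums of two squares and vanishing coefficients -/

section Vanishing

theorem coeff_pentSeries_mul_dilate_psiSeries {M : ℕ}
    (h : coeff M (pentSeries * dilate 3 psiSeries) ≠ 0) :
    ∃ x y : ℕ, 24 * M + 10 = x ^ 2 + y ^ 2 := by
  rw [coeff_mul] at h
  obtain ⟨⟨i, j⟩, hij, hne⟩ := Finset.exists_ne_zero_of_sum_ne_zero h
  rw [Finset.HasAntidiagonal.mem_antidiagonal] at hij
  simp only [pentSeries, psiSeries, coeff_mk, coeff_dilate] at hne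
  have hi : IsSquare (24 * i + 1) := by
    by_contra hi
    simp [hi] at hne
  have h3 : 3 ∣ j := by
    by_contra h3
    simp [h3] at hne
  obtain ⟨k, rfl⟩ := h3
  rw [Nat.mul_div_cancel_left _ (by decide)] at hne
  have hk : IsSquare (8 * k + 1) := by
    by_contra hk
    simp [hk] at hne
  obtain ⟨x, hx⟩ := hi
  obtain ⟨y, hy⟩ := hk
  -- With `M = i + 3k`, `24M + 10 = (24i + 1) + 9(8k + 1)`.
  exact ⟨x, 3 * y, by simp only at hij; subst hij; linarith⟩

/-- A prime `p ≡ 3 [MOD 4]` dividing a sum of two squares divides it at least twice. -/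
theorem sq_dvd_of_dvd_sq_add_sq {p : ℕ} (hp : p.Prime) (hp4 : p % 4 = 3) {x y : ℕ}
    (h : p ∣ x ^ 2 + y ^ 2) : p ^ 2 ∣ x ^ 2 + y ^ 2 := by
  have := Fact.mk hp
  have key : ∀ a b : ℕ, p ∣ a ^ 2 + b ^ 2 → p ∣ a := by
    intro a b hab
    have h0 : (a : ZMod p) ^ 2 + (b : ZMod p) ^ 2 = 0 := by
      rw [← ZMod.natCast_eq_zero_iff] at hab
      exact_mod_cast hab
    rw [← ZMod.natCast_eq_zero_iff]
    by_contra ha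
    have h1 : (b : ZMod p) ^ 2 = -(a : ZMod p) ^ 2 := by linear_combination h0
    exact ZMod.mod_four_ne_three_of_sq_eq_neg_sq' ha h1 hp4
  exact dvd_add (pow_dvd_pow_of_dvd (key x y h) 2)
    (pow_dvd_pow_of_dvd (key y x (by rwa [add_comm])) 2)

/-- Here `24M + 10 = p (p (24n + 10) + 24r)`, and `p ∤ 24r` because `p ≥ 5` and `0 < r < p`. -/
theorem coeff_pentSeries_mul_eq_zero {p : ℕ} (hp : p.Prime) (hp4 : p % 4 = 3) (hp5 : 5 ≤ p)
    {n r M : ℕ} (hr1 : 1 ≤ r) (hrp : r < p)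
    (hM : 12 * M + 5 = 12 * p ^ 2 * n + 12 * p * r + 5 * p ^ 2) :
    coeff M (pentSeries * dilate 3 psiSeries) = 0 := by
  by_contra h
  obtain ⟨x, y, hxy⟩ := coeff_pentSeries_mul_dilate_psiSeries h
  have h1 : x ^ 2 + y ^ 2 = p ^ 2 * (24 * n + 10) + p * (24 * r) := by
    rw [← hxy]
    linear_combination 2 * hM
  have h2 : p ^ 2 ∣ x ^ 2 + y ^ 2 := sq_dvd_of_dvd_sq_add_sq hp hp4
    (h1 ▸ dvd_add (Dvd.dvd.mul_right (dvd_pow_self p two_ne_zero) _) (dvd_mul_right _ _))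
  rw [h1, Nat.dvd_add_right (dvd_mul_right _ _), pow_two,
    Nat.mul_dvd_mul_iff_left hp.pos, hp.dvd_mul] at h2
  rcases h2 with h2 | h2
  · have := (hp.dvd_mul (m := 8) (n := 3)).1 h2
    rcases this with h8 | h3
    · have := Nat.le_of_dvd (by norm_num) (hp.dvd_of_dvd_pow (m := 2) (n := 3) h8)
      omega
    · have := Nat.le_of_dvd (by norm_num) h3
      omega
  · exact absurd (Nat.le_of_dvd hr1 h2) (not_le.2 hrp)

theorem dvd_coeff_sectionOne {M : ℕ} (h : coeff M (pentSeries * dilate 3 psiSeries) = 0) :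
    (9 : ℤ) ∣ coeff (3 * M + 1) (eulerSeries 12 * tripleSeries) := by
  have h9 : (9 : ℤ⟦X⟧) = ((9 : ℤ) : ℤ⟦X⟧) := by norm_num
  have h2 := sectionOne_tripleSeries_congr
  rw [h9, intCast_dvd_iff] at h2
  have h3 := h2 M
  have c2 : (2 : ℤ⟦X⟧) = C 2 := by simp
  have c3 : (3 : ℤ⟦X⟧) = C 3 := by simp
  rwa [map_sub, map_add, c2, c3, coeff_C_mul, coeff_C_mul, coeff_theta, h, mul_zero, mul_zero,
    mul_zero, add_zero, sub_zero, sectionOne, coeff_mk] at h3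

theorem two_mul_index (k : ℤ) : 6 * k * (3 * k + 1) = 12 * (pentagonal (-k) : ℤ) := by
  linear_combination -6 * two_mul_natCast_pentagonal_neg k

/-- The alternating sums of `tripleCount` are the coefficients of `f₁₂ · ∑ B(m) q ^ m`. -/
theorem hasFiniteSupport_and_finsum_eq (N : ℕ) :
    (Function.support fun k : ℤ =>
      (k.negOnePow : ℤ) * tripleCountInt (N - 6 * k * (3 * k + 1))).Finite ∧
    ∑ᶠ k : ℤ, (k.negOnePow : ℤ) * tripleCountInt (N - 6 * k * (3 * k + 1)) =
      coeff N (eulerSeries 12 * tripleSeries) := by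
  classical
  have hsub : (Function.support fun k : ℤ =>
      (k.negOnePow : ℤ) * tripleCountInt (N - 6 * k * (3 * k + 1))) ⊆
      (Finset.Icc (-N : ℤ) N : Finset ℤ) := by
    intro k hk
    rw [Function.mem_support] at hk
    have h0 : (0 : ℤ) ≤ N - 6 * k * (3 * k + 1) := by
      by_contra h0
      rw [tripleCountInt, if_neg h0, mul_zero] at hk
      exact hk rfl
    rw [Finset.coe_Icc, Set.mem_Icc]
    constructor <;> rcases le_or_gt k 0 with h | h <;> nlinarith
  refine ⟨(Finset.finite_toSet _).subset hsub, ?_⟩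
  rw [finsum_eq_sum_of_support_subset _ hsub, coeff_mul]
  symm
  -- Both sums are cut down to their possibly nonzero terms, which `k ↦ 12 * pentagonal (-k)`
  -- matches bijectively.
  rw [← Finset.sum_filter_of_ne (p := fun x : ℕ × ℕ => ∃ k : ℤ, 12 * pentagonal (-k) = x.1)]
  · rw [← Finset.sum_filter_of_ne (s := Finset.Icc (-N : ℤ) N)
      (p := fun k : ℤ => 12 * pentagonal (-k) ≤ N)]
    · symm
      refine Finset.sum_bij
        (fun k _ => (12 * pentagonal (-k), N - 12 * pentagonal (-k))) ?_ ?_ ?_ ?_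
      · intro k hk
        rw [Finset.mem_filter] at hk ⊢
        exact ⟨by rw [Finset.HasAntidiagonal.mem_antidiagonal]; exact Nat.add_sub_cancel' hk.2,
          k, rfl⟩
      · intro k _ l _ h
        have h1 : 12 * pentagonal (-k) = 12 * pentagonal (-l) := congrArg Prod.fst h
        have h2 := pentagonal_injective (Nat.eq_of_mul_eq_mul_left (by decide) h1)
        exact neg_injective h2
      · rintro ⟨i, j⟩ hij
        rw [Finset.mem_filter, Finset.HasAntidiagonal.mem_antidiagonal] at hij
        obtain ⟨h1, k, h2⟩ := hij
        simp only at h1 h2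
        refine ⟨k, ?_, ?_⟩
        · have h3 := two_mul_natCast_pentagonal_neg k
          rw [Finset.mem_filter, Finset.mem_Icc]
          have h4 : (12 * pentagonal (-k) : ℤ) ≤ N := by
            rw [← h1, ← h2]
            push_cast
            omega
          refine ⟨?_, by omega⟩
          constructor <;> rcases le_or_gt k 0 with h | h <;> nlinarith
        · ext
          · exact h2
          · show N - 12 * pentagonal (-k) = j
            omega
      · intro k hk
        rw [Finset.mem_filter] at hk
        rw [two_mul_index, tripleCountInt, if_pos (by have := hk.2; omega), eulerSeries,
          coeff_dilate, if_pos (dvd_mul_right _ _), Nat.mul_div_cancel_left _ (by decide),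
          coeff_pentagonalSeries_pentagonal, Int.negOnePow_neg, tripleSeries, coeff_mk,
          Int.cast_id]
        congr 3
        have := hk.2
        omega
    · intro k _ hk
      by_contra h
      rw [two_mul_index, tripleCountInt, if_neg (by omega), mul_zero] at hk
      exact hk rfl
  · rintro ⟨i, j⟩ _ hne
    by_contra hk
    push Not at hk
    simp only at hk hne
    refine hne ?_
    rw [eulerSeries, coeff_dilate]
    split_ifs with h12
    · obtain ⟨c, rfl⟩ := h12
      rw [Nat.mul_div_cancel_left _ (by decide), coeff_pentagonalSeries_eq_zero, zero_mul]
      rintro ⟨l, rfl⟩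
      exact hk (-l) (by rw [neg_neg])
    · rw [zero_mul]

end Vanishing

theorem theorem1p5 (p : ℕ) (hp : p.Prime) (hp12 : p ≡ 7 [MOD 12] ∨ p ≡ 11 [MOD 12])
    (n r : ℕ) (hr1 : 1 ≤ r) (hrp : r ≤ p - 1) :
    (Function.support fun k : ℤ =>
      (k.negOnePow : ℤ) *
        tripleCountInt (3 * (p : ℤ) ^ 2 * n + 3 * p * r + 5 * ((p : ℤ) ^ 2 - 1) / 4 + 1
          - 6 * k * (3 * k + 1))).Finite ∧
    (∑ᶠ k : ℤ,
      (k.negOnePow : ℤ) *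
        tripleCountInt (3 * (p : ℤ) ^ 2 * n + 3 * p * r + 5 * ((p : ℤ) ^ 2 - 1) / 4 + 1
          - 6 * k * (3 * k + 1))) ≡ 0 [ZMOD 9] := by
  have hmod : p % 12 = 7 ∨ p % 12 = 11 := hp12
  have hp2 : 2 ≤ p := hp.two_le
  obtain ⟨c, hc⟩ : ∃ c : ℕ, p ^ 2 = 12 * c + 1 := by
    have h : p ^ 2 % 12 = 1 := by
      rw [Nat.pow_mod]
      rcases hmod with h | h <;> rw [h]
    exact ⟨p ^ 2 / 12, by omega⟩
  have hcz : (p : ℤ) ^ 2 = 12 * c + 1 := by exact_mod_cast hc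
  set M : ℕ := p ^ 2 * n + p * r + 5 * c with hM
  have hN : 3 * (p : ℤ) ^ 2 * n + 3 * p * r + 5 * ((p : ℤ) ^ 2 - 1) / 4 + 1 =
      ((3 * M + 1 : ℕ) : ℤ) := by
    -- The integer division by 4 is exact, as `p² = 12c + 1`.
    rw [show 5 * ((p : ℤ) ^ 2 - 1) = 4 * (15 * c) by rw [hcz]; ring,
      Int.mul_ediv_cancel_left _ (by norm_num), hM]
    push_cast
    ring
  rw [hN]
  obtain ⟨hfin, hsum⟩ := hasFiniteSupport_and_finsum_eq (3 * M + 1)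
  refine ⟨hfin, ?_⟩
  rw [hsum, Int.modEq_zero_iff_dvd]
  refine dvd_coeff_sectionOne (coeff_pentSeries_mul_eq_zero hp (n := n) (r := r) (by omega)
    (by omega) hr1 (by omega) ?_)
  rw [hM]
  linarith
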